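/- **Setting.** An instance of the joint replenishment problem with deadlines consists of a warehouse ordering cost $C\ge 0$, retailer ordering costs $c_\rho\ge 0$ ($\rho=1,\dots,m$), and a finite set $\mathcal D$ of demands $(\rho,r,d)$ with retailer $\rho$, release time $r\ge 1$ and deadline $d$ (integers). A schedule is a finite set of orders $(t,R)$ with $t$ a time and $R$ a set of retailers; its cost is the sum of $C+\sum_{\rho\in R}c_\rho$ over its orders. It is feasible if each demand $(\rho,r,d)$ has an order $(t,R)$ with $\rho\in R$ and $r\le t\le d$. Let $U$ be the largest deadline ($U=0$ if $\mathcal D=\emptyset$). A fractional solution $\boldsymbol x$ consists of numbers $x_t, x^\rho_t\ge 0$ for $t\in\{1,\dots,U\}$ with $x_t\ge x_t^\rho$ for all $t,\rho$ and $\sum_{t=r}^d x^\rho_t\ge 1$ for all $(\rho,r,d)\in\mathcal D$; its cost is $\mathrm{cost}(\boldsymbol x)=\sum_{t=1}^U\big(C x_t+\sum_\rho c_\rho x^\rho_t\big)$. **The statistic $\beta(p)$.** Let $p$ be a probability distribution on $[0,1]$ other than the point mass at $0$, with mean $\mathbf E[p]$. In the tally game with threshold $z\ge 0$, draw independent samples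 $s_1,s_2,\dots,s_h$ from $p$, stopping when their sum exceeds $z$; the waste is $z-(s_1+\dots+s_{h-1})$, and $\mathcal W(p,z)$ is its expectation. Put $\beta(p)=\min\{\mathbf E[p],\,1-\sup_{z\ge 0}\mathcal W(p,z)\}$. **The algorithm $\mathrm{ROUND}_p$.** Let $\hat U=\sum_{t=1}^U x_t$. For each retailer $\rho$ let $\omega^\rho$ be the continuous piecewise linear function on $[0,\hat U]$ with $\omega^\rho(0)=0$ that satisfies $\omega^\rho\big(\sum_{t=1}^T x_t\big)=\sum_{t=1}^T x^\rho_t$ for $T=1,\dots,U$ and is linear between these breakpoints. 1. Draw independent samples $s_1,s_2,\dots$ from $p$, and let $g_i=s_1+\dots+s_i$ and $g_0=0$. Let $I=\min\{i\ge 0: g_i>\hat U-1\}$ and $G=(g_1,\dots,g_I)$. 2. For each retailer $\rho$ choose local cutoffs greedily: $\ell^\rho_0=0$, and $\ell^\rho_{j}$ is the largest $g\in G$ such that $\omega^\rho(y)-\omega^\rho(\ell^\rho_{j-1})<1$ for all $y\in[0,g)$. Let $J_\rho=\min\{j\ge 0:\omega^\rho(\hat U)-\omega^\rho(\ell^\rho_j)<1\}$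 and $L^\rho=\{\ell^\rho_1,\dots,\ell^\rho_{J_\rho}\}$. 3. For each $g_i\in G$ let $t_i$ be the smallest $t\in\{1,\dots,U\}$ with $\sum_{t'=1}^{t}x_{t'}\ge g_i$. Return the schedule $\{(t_i,\{\rho: g_i\in L^\rho\}) : g_i\in G\}$. **Lemma.** For every instance, every fractional solution $\boldsymbol x$ and every probability distribution $p$ on $[0,1]$ other than the point mass at $0$, the algorithm $\mathrm{ROUND}_p$ almost surely returns (in particular every step is well defined), and the returned schedule is feasible. The cost of the returned schedule has finite expectation, and if $\beta(p)>0$, this expectation is at most $\mathrm{cost}(\boldsymbol x)/\beta(p)$. -/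

import Mathlib

open MeasureTheory

noncomputable section

namespace JRPD

/-! ### Instances, schedules and the LP relaxation -/

/-- An instance of the joint replenishment problem with deadlines, with retailers `Fin m`:
warehouse ordering cost `C`, retailer ordering costs `c ρ`, and a finite set of demands
`(ρ, r, d)` (retailer, release time, deadline). Times are `1, 2, 3, …`. -/
structure Problem (m : ℕ) where
  C : ℝ
  c : Fin m → ℝ
  demands : Finset (Fin m × ℕ × ℕ)
  C_nonneg : 0 ≤ C
  c_nonneg : ∀ ρ, 0 ≤ c ρ
  release_pos : ∀ ρ r d, (ρ, r, d) ∈ demands → 1 ≤ r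

/-- An order `(t, R)`: its time and the set of retailers that join it. -/
abbrev Order (m : ℕ) := ℕ × Finset (Fin m)

/-- A schedule is a finite set of orders. -/
abbrev Schedule (m : ℕ) := Finset (Order m)

variable {m : ℕ}

/-- The maximum deadline `U` (which is `0` if there is no demand). -/
def Problem.U (P : Problem m) : ℕ := P.demands.sup (fun q => q.2.2)

/-- Every demand `(ρ, r, d)` is satisfied by an order `(t, R)` with `ρ ∈ R` and `t ∈ [r, d]`. -/
def Problem.Feasible (P : Problem m) (S : Schedule m) : Prop :=
  ∀ ρ r d, (ρ, r, d) ∈ P.demands → ∃ o ∈ S, ρ ∈ o.2 ∧ r ≤ o.1 ∧ o.1 ≤ d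

/-- The cost of a schedule: the sum over its orders `(t, R)` of `C + ∑ ρ ∈ R, c ρ`. -/
def Problem.cost (P : Problem m) (S : Schedule m) : ℝ :=
  ∑ o ∈ S, (P.C + ∑ ρ ∈ o.2, P.c ρ)

/-- LP variables: `w t` is the warehouse variable `x_t`, and `ret ρ t` is the retailer
variable `x^ρ_t`. Only the times `t ∈ {1, …, U}` matter. -/
structure LPPoint (m : ℕ) where
  w : ℕ → ℝ
  ret : Fin m → ℕ → ℝ

/-- The constraints of the LP relaxation: `x` is a fractional solution. -/
structure LPFeasible (P : Problem m) (x : LPPoint m) : Prop where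
  le_w : ∀ t ∈ Finset.Icc 1 P.U, ∀ ρ, x.ret ρ t ≤ x.w t
  cover : ∀ ρ r d, (ρ, r, d) ∈ P.demands → 1 ≤ ∑ t ∈ Finset.Icc r d, x.ret ρ t
  w_nonneg : ∀ t ∈ Finset.Icc 1 P.U, 0 ≤ x.w t
  ret_nonneg : ∀ t ∈ Finset.Icc 1 P.U, ∀ ρ, 0 ≤ x.ret ρ t

/-- The LP objective. -/
def lpCost (P : Problem m) (x : LPPoint m) : ℝ :=
  ∑ t ∈ Finset.Icc 1 P.U, (P.C * x.w t + ∑ ρ, P.c ρ * x.ret ρ t)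

/-! ### Samples, the tally game and the statistic `β` -/

/-- The law of a sequence of independent samples from `p`; `s k` is the sample number `k + 1`. -/
def sampleLaw (p : Measure unitInterval) : Measure (ℕ → unitInterval) :=
  Measure.infinitePi (fun _ : ℕ => p)

/-- The sum of the first `i` samples. -/
def partialSum (s : ℕ → unitInterval) (i : ℕ) : ℝ := ∑ k ∈ Finset.range i, (s k : ℝ)

/-- The number `h` of samples drawn in the tally game with threshold `z`: the first `h` such
that the sum of the first `h` samples exceeds `z`. -/
def tallyLength (z : ℝ) (s : ℕ → unitInterval) : ℕ := sInf {h | z < partialSum s h}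

/-- The waste: the threshold minus the sum of all the drawn samples but the last. -/
def waste (z : ℝ) (s : ℕ → unitInterval) : ℝ := z - partialSum s (tallyLength z s - 1)

/-- The expected waste for the threshold `z`. -/
def expectedWaste (p : Measure unitInterval) (z : ℝ) : ℝ := ∫ s, waste z s ∂(sampleLaw p)

/-- The expected value of a single sample. -/
def mean (p : Measure unitInterval) : ℝ := ∫ y, (y : ℝ) ∂p

/-- The statistic `β(p)`; the supremum is over all thresholds `z ≥ 0`. -/
def beta (p : Measure unitInterval) : ℝ :=
  min (mean p) (1 - ⨆ z : NNReal, expectedWaste p z)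

/-! ### The rounding algorithm -/

/-- `x_1 + ⋯ + x_T`. -/
def cumul (x : LPPoint m) (T : ℕ) : ℝ := ∑ t ∈ Finset.Icc 1 T, x.w t

/-- `Û = x_1 + ⋯ + x_U`. -/
def total (P : Problem m) (x : LPPoint m) : ℝ := cumul x P.U

/-- The piecewise linear continuous function `ω^ρ` on `[0, Û]` with value `x^ρ_1 + ⋯ + x^ρ_T` at
the point `x_1 + ⋯ + x_T`, for `T = 0, …, U`: between the breakpoints number `t - 1` and `t` it
grows linearly by `x^ρ_t`. (A time with `x_t = 0` has `x^ρ_t = 0` and contributes nothing.) -/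
def omega (P : Problem m) (x : LPPoint m) (ρ : Fin m) (z : ℝ) : ℝ :=
  ∑ t ∈ Finset.Icc 1 P.U, x.ret ρ t * max 0 (min 1 ((z - cumul x (t - 1)) / x.w t))

/-- The length `I` of the global cutoff sequence: the first `i` with `g_i > Û - 1`, where
`g_i` is the sum of the first `i` samples. -/
def globalLength (P : Problem m) (x : LPPoint m) (s : ℕ → unitInterval) : ℕ :=
  sInf {i | total P x - 1 < partialSum s i}

/-- The set of global cutoffs `{g_1, …, g_I}`. -/
def globalCutoffs (P : Problem m) (x : LPPoint m) (s : ℕ → unitInterval) : Finset ℝ :=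
  (Finset.Icc 1 (globalLength P x s)).image (partialSum s)

/-- The global cutoffs that retailer `ρ` may choose after the local cutoff `a`: those that
do not lie beyond the first point at which `ω^ρ` has grown by `1` since `a`. -/
def candidates (P : Problem m) (x : LPPoint m) (s : ℕ → unitInterval) (ρ : Fin m) (a : ℝ) :
    Set ℝ :=
  {g | g ∈ globalCutoffs P x s ∧ ∀ y, 0 ≤ y → y < g → omega P x ρ y - omega P x ρ a < 1}

/-- The greedy local cutoffs: `ℓ_0 = 0`, and `ℓ_{j+1}` is the largest candidate after `ℓ_j`. -/
def localCutoff (P : Problem m) (x : LPPoint m) (s : ℕ → unitInterval) (ρ : Fin m) : ℕ → ℝ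
  | 0 => 0
  | j + 1 => sSup (candidates P x s ρ (localCutoff P x s ρ j))

/-- The length `J` of the local cutoff sequence of `ρ`: the first `j` with
`ω^ρ(Û) - ω^ρ(ℓ_j) < 1`. -/
def localLength (P : Problem m) (x : LPPoint m) (s : ℕ → unitInterval) (ρ : Fin m) : ℕ :=
  sInf {j | omega P x ρ (total P x) - omega P x ρ (localCutoff P x s ρ j) < 1}

/-- The set of local cutoffs `{ℓ_1, …, ℓ_J}` of `ρ`. -/
def localCutoffs (P : Problem m) (x : LPPoint m) (s : ℕ → unitInterval) (ρ : Fin m) : Finset ℝ :=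
  (Finset.Icc 1 (localLength P x s ρ)).image (localCutoff P x s ρ)

/-- The order time of a cutoff `g`: the first `t ∈ {1, …, U}` with `x_1 + ⋯ + x_t ≥ g`. -/
def orderTime (P : Problem m) (x : LPPoint m) (g : ℝ) : ℕ :=
  sInf {t | t ∈ Finset.Icc 1 P.U ∧ g ≤ cumul x t}

open Classical in
/-- The schedule built from the global and local cutoffs. -/
def roundSchedule (P : Problem m) (x : LPPoint m) (s : ℕ → unitInterval) : Schedule m :=
  (globalCutoffs P x s).image
    (fun g => (orderTime P x g, Finset.univ.filter (fun ρ => g ∈ localCutoffs P x s ρ)))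

/-- Every minimum and maximum taken by the algorithm exists: the two cutoff sequences end, every
local cutoff is chosen from a nonempty set, and every global cutoff has an order time. -/
structure Halts (P : Problem m) (x : LPPoint m) (s : ℕ → unitInterval) : Prop where
  globalStop : ∃ i, total P x - 1 < partialSum s i
  localStop : ∀ ρ, ∃ j, omega P x ρ (total P x) - omega P x ρ (localCutoff P x s ρ j) < 1
  localChoice : ∀ ρ, ∀ j < localLength P x s ρ,
    (candidates P x s ρ (localCutoff P x s ρ j)).Nonempty
  timeExists : ∀ g ∈ globalCutoffs P x s, ∃ t ∈ Finset.Icc 1 P.U, g ≤ cumul x t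

open Classical in
/-- The algorithm, run on the samples `s`: the schedule it returns, or `none` if it does not
return. -/
def round (P : Problem m) (x : LPPoint m) (s : ℕ → unitInterval) : Option (Schedule m) :=
  if Halts P x s then some (roundSchedule P x s) else none

/-- The cost of the outcome of a run (`0` if the run returns no schedule). -/
def runCost (P : Problem m) (x : LPPoint m) (s : ℕ → unitInterval) : ℝ :=
  (round P x s).elim 0 P.cost

end JRPD

end

/-!
The algorithm returns as soon as the partial sums `g_i` of the samples exceed `Û - 1`, which happens
almost surely because the mean of `p` is positive (`mean_pos`, `ae_exists_lt_partialSum`). The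
functions `ω^ρ` are monotone and 1-Lipschitz (`omega_mono`, `omega_sub_le`), global cutoffs are at
most `1` apart, and the last one exceeds `Û - 1`; hence a retailer whose `ω^ρ` can still grow by `1`
always finds a strictly larger local cutoff (`exists_candidate_gt`), and no interval on which `ω^ρ`
grows by `1` is missed (`exists_localCutoff_mem_Ioc`). The latter is feasibility, since the
constraint of a demand `(ρ, r, d)` says that `ω^ρ` grows by `1` between the breakpoints `r - 1`
and `d`.

The cost of the schedule is at most `C * I + ∑ ρ, c_ρ * J_ρ`, where `I` is the number of global
cutoffs and `J_ρ` the number of local cutoffs of `ρ`. So the bound reduces to `E[I] ≤ Û / β(p)` and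
`E[J_ρ] ≤ ω^ρ(Û) / β(p)`. The first is Wald's inequality (`lintegral_countLE_le`).

For the second, let `λ` be the point at which `ω^ρ` has grown by `1` since the last local cutoff
`ℓ`. The next local cutoff is the last partial sum `g ≤ λ`, so `ω^ρ` grows by at least `1 - (λ - g)`
from `ℓ` to it, and `λ - g` is the waste of a tally game. This game has to be started with care:
the sample that follows `ℓ` is known to pass the previous threshold, so it is not distributed
according to `p`. The first partial sum `g'` beyond the previous threshold is the right starting
point: it is at most `ℓ + 1 ≤ λ`, and the samples after it are fresh, so that `λ - g` is the waste
for the threshold `λ - g' ≥ 0`, of expectation at most `1 - β(p)`. Instead of conditioning on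
stopping times, the proof reads the samples one by one (`cutoffCount`) and bounds `β(p)` times the
expected count by induction on the number of samples, with the potential
`ω^ρ(Û) - ω^ρ(λ) + W(p, λ - g)` in the state with threshold `λ` and partial sum `g`
(`lintegral_cutoffCount_le`). The sum of the potential and `β(p)` times the count does not increase
on average, by the renewal inequality `lintegral_renewal_le` for the expected waste.
-/

noncomputable section

namespace JRPD

open Set
open scoped ENNReal

/-! ### Independent samples: splitting off the first one -/

/-- The sample sequence with first term `y` and remaining terms `t`. -/
def consSample (y : unitInterval) (t : ℕ → unitInterval) : ℕ → unitInterval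
  | 0 => y
  | n + 1 => t n

lemma measurable_consSample :
    Measurable (fun q : unitInterval × (ℕ → unitInterval) => consSample q.1 q.2) := by
  refine measurable_pi_iff.2 fun n => ?_
  cases n with
  | zero => exact measurable_fst
  | succ n => exact (measurable_pi_apply n).comp measurable_snd

instance (p : Measure unitInterval) [IsProbabilityMeasure p] :
    IsProbabilityMeasure (sampleLaw p) := by
  unfold sampleLaw; infer_instance

lemma map_consSample (p : Measure unitInterval) [IsProbabilityMeasure p] :
    (p.prod (sampleLaw p)).map (fun q => consSample q.1 q.2) = sampleLaw p := by
  classical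
  refine Measure.eq_infinitePi _ fun S t ht => ?_
  -- Enlarging `S` to an initial segment, with full factors at the new indices, lets the product
  -- over `S` be split at its first index.
  set n := S.sup id
  let t' : ℕ → Set unitInterval := fun i => if i ∈ S then t i else univ
  have ht' : ∀ i, MeasurableSet (t' i) := fun i => by
    by_cases h : i ∈ S <;> simp [t', h, ht]
  have hS : ∀ i ∈ S, i < n + 1 := fun i hi =>
    Nat.lt_succ_of_le (Finset.le_sup (f := id) hi)
  have hprod : ∏ i ∈ S, p (t i) = ∏ i ∈ Finset.range (n + 1), p (t' i) := by
    rw [← Finset.prod_subset (fun i hi => Finset.mem_range.2 (hS i hi))]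
    · exact Finset.prod_congr rfl fun i hi => by simp [t', hi]
    · intro i _ hi; simp [t', hi]
  have hbox : (fun q : unitInterval × (ℕ → unitInterval) => consSample q.1 q.2) ⁻¹' (Set.pi S t)
      = t' 0 ×ˢ Set.pi (Finset.range n) (fun i => t' (i + 1)) := by
    ext ⟨y, s⟩
    simp only [mem_preimage, Set.mem_pi, mem_prod, SetLike.mem_coe, Finset.mem_range]
    constructor
    · intro h
      refine ⟨?_, fun i _ => ?_⟩
      · by_cases h0 : 0 ∈ S
        · simpa [t', h0, consSample] using h 0 h0
        · simp [t', h0]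
      · by_cases h0 : i + 1 ∈ S
        · simpa [t', h0, consSample] using h (i + 1) h0
        · simp [t', h0]
    · rintro ⟨h0, h1⟩ i hi
      cases i with
      | zero => simpa [t', hi, consSample] using h0
      | succ i => simpa [t', hi, consSample] using h1 i (by have := hS _ hi; omega)
  rw [Measure.map_apply measurable_consSample (.pi S.countable_toSet fun i _ => ht i), hbox,
    Measure.prod_prod, hprod, Finset.prod_range_succ', mul_comm, sampleLaw,
    Measure.infinitePi_pi _ fun i _ => ht' (i + 1)]

/-- No measurability is needed for this direction of Tonelli's theorem, so that expectations of
recursively defined functions of the samples can be bounded from above by induction. -/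
lemma lintegral_sampleLaw_le (p : Measure unitInterval) [IsProbabilityMeasure p]
    (f : (ℕ → unitInterval) → ℝ≥0∞) :
    ∫⁻ s, f s ∂(sampleLaw p) ≤ ∫⁻ y, ∫⁻ t, f (consSample y t) ∂(sampleLaw p) ∂p := by
  conv_lhs => rw [← map_consSample p]
  exact (lintegral_map_le _ _).trans (lintegral_prod_le _)

lemma lintegral_sampleLaw (p : Measure unitInterval) [IsProbabilityMeasure p]
    {f : (ℕ → unitInterval) → ℝ≥0∞} (hf : Measurable f) :
    ∫⁻ s, f s ∂(sampleLaw p) = ∫⁻ y, ∫⁻ t, f (consSample y t) ∂(sampleLaw p) ∂p := by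
  conv_lhs => rw [← map_consSample p]
  rw [lintegral_map hf measurable_consSample]
  exact lintegral_prod _ (hf.comp measurable_consSample).aemeasurable

/-! ### Partial sums -/

lemma partialSum_zero (s : ℕ → unitInterval) : partialSum s 0 = 0 := by simp [partialSum]

lemma partialSum_succ (s : ℕ → unitInterval) (i : ℕ) :
    partialSum s (i + 1) = partialSum s i + s i := by
  simp [partialSum, Finset.sum_range_succ]

lemma partialSum_consSample (y : unitInterval) (t : ℕ → unitInterval) (i : ℕ) :
    partialSum (consSample y t) (i + 1) = y + partialSum t i := by
  simp [partialSum, Finset.sum_range_succ', consSample, add_comm]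

lemma partialSum_mono (s : ℕ → unitInterval) : Monotone (partialSum s) :=
  monotone_nat_of_le_succ fun i => by
    rw [partialSum_succ]; linarith [(s i).2.1]

lemma partialSum_nonneg (s : ℕ → unitInterval) (i : ℕ) : 0 ≤ partialSum s i :=
  (partialSum_zero s).ge.trans (partialSum_mono s (Nat.zero_le i))

lemma partialSum_succ_le (s : ℕ → unitInterval) (i : ℕ) :
    partialSum s (i + 1) ≤ partialSum s i + 1 := by
  rw [partialSum_succ]; linarith [(s i).2.2]

lemma measurable_partialSum (i : ℕ) : Measurable (fun s => partialSum s i) := by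
  unfold partialSum
  exact Finset.measurable_sum _ fun k _ => measurable_subtype_coe.comp (measurable_pi_apply k)

/-! ### Wald's inequality -/

lemma mean_nonneg (p : Measure unitInterval) : 0 ≤ mean p := integral_nonneg fun y => y.2.1

lemma integrable_coe (p : Measure unitInterval) [IsProbabilityMeasure p] :
    Integrable (fun y : unitInterval => (y : ℝ)) p :=
  Integrable.of_bound measurable_subtype_coe.aestronglyMeasurable 1
    (Filter.Eventually.of_forall fun y => by
      rw [Real.norm_of_nonneg y.2.1]; exact y.2.2)

lemma mean_pos (p : Measure unitInterval) [IsProbabilityMeasure p]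
    (hp : p ≠ Measure.dirac 0) : 0 < mean p := by
  refine lt_of_le_of_ne (mean_nonneg p) fun h => hp ?_
  have h0 : (fun y : unitInterval => (y : ℝ)) =ᵐ[p] 0 :=
    (integral_eq_zero_iff_of_nonneg (fun y : unitInterval => y.2.1) (integrable_coe p)).1 h.symm
  have h1 : (fun y : unitInterval => y) =ᵐ[p] fun _ => 0 := by
    filter_upwards [h0] with y hy using Subtype.ext hy
  calc p = p.map (fun y => y) := Measure.map_id'.symm
    _ = p.map (fun _ => 0) := Measure.map_congr h1
    _ = Measure.dirac 0 := by rw [Measure.map_const, measure_univ, one_smul]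

/-- The number of partial sums `g_i ≤ c`, over `i < n`. -/
def countLE (n : ℕ) (c : ℝ) (s : ℕ → unitInterval) : ℝ≥0∞ :=
  ∑ i ∈ Finset.range n, if partialSum s i ≤ c then 1 else 0

lemma countLE_consSample (n : ℕ) (c : ℝ) (y : unitInterval) (t : ℕ → unitInterval) :
    countLE (n + 1) c (consSample y t) = (if 0 ≤ c then 1 else 0) + countLE n (c - y) t := by
  simp only [countLE, Finset.sum_range_succ', partialSum_zero, partialSum_consSample,
    le_sub_iff_add_le', add_comm]

lemma countLE_of_neg (n : ℕ) {c : ℝ} (hc : c < 0) (s : ℕ → unitInterval) :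
    countLE n c s = 0 :=
  Finset.sum_eq_zero fun i _ => if_neg (by linarith [partialSum_nonneg s i])

lemma measurable_countLE (n : ℕ) (c : ℝ) : Measurable (countLE n c) :=
  Finset.measurable_sum _ fun i _ => Measurable.ite
    (measurableSet_le (measurable_partialSum i) measurable_const) measurable_const measurable_const

lemma lintegral_countLE_le (p : Measure unitInterval) [IsProbabilityMeasure p]
    (hμ : 0 < mean p) (n : ℕ) (c : ℝ) :
    ∫⁻ s, countLE n c s ∂(sampleLaw p) ≤ ENNReal.ofReal ((c + 1) / mean p) := by
  induction n generalizing c with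
  | zero => simp [countLE]
  | succ n ih =>
    rcases lt_or_ge c 0 with hc | hc
    · simp [countLE_of_neg _ hc]
    refine (lintegral_sampleLaw_le p _).trans ?_
    simp only [countLE_consSample, if_pos hc]
    have hint : Integrable (fun y : unitInterval => 1 + (c - (y : ℝ) + 1) / mean p) p :=
      (integrable_const _).add ((((integrable_const _).sub (integrable_coe p)).add
        (integrable_const _)).div_const _)
    calc ∫⁻ y, ∫⁻ t, (1 + countLE n (c - y) t) ∂(sampleLaw p) ∂p
        ≤ ∫⁻ y, ENNReal.ofReal (1 + (c - y + 1) / mean p) ∂p := by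
          refine lintegral_mono fun y => ?_
          rw [lintegral_add_left measurable_const, lintegral_const, measure_univ, one_mul,
            ENNReal.ofReal_add zero_le_one (div_nonneg (by linarith [y.2.2]) hμ.le),
            ENNReal.ofReal_one]
          gcongr
          exact ih _
      _ = ENNReal.ofReal (∫ y, (1 + (c - (y : ℝ) + 1) / mean p) ∂p) := by
          refine (ofReal_integral_eq_lintegral_ofReal hint ?_).symm
          refine Filter.Eventually.of_forall fun y => ?_
          have : 0 ≤ (c - (y : ℝ) + 1) / mean p := div_nonneg (by linarith [y.2.2]) hμ.le
          simp only [Pi.zero_apply]; linarith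
      _ = ENNReal.ofReal ((c + 1) / mean p) := by
          congr 1
          have h : ∀ y : unitInterval, 1 + (c - (y : ℝ) + 1) / mean p
              = (1 + (c + 1) / mean p) - (y : ℝ) / mean p := fun y => by ring
          simp_rw [h]
          rw [integral_sub (integrable_const _) ((integrable_coe p).div_const _), integral_div,
            integral_const, probReal_univ, one_smul]
          change 1 + (c + 1) / mean p - mean p / mean p = _
          rw [div_self hμ.ne']
          ring

lemma iSup_countLE (c : ℝ) (s : ℕ → unitInterval) :
    ⨆ n, countLE n c s = ∑' i, if partialSum s i ≤ c then (1 : ℝ≥0∞) else 0 :=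
  ENNReal.tsum_eq_iSup_nat.symm

lemma lintegral_iSup_countLE_le (p : Measure unitInterval) [IsProbabilityMeasure p]
    (hμ : 0 < mean p) (c : ℝ) :
    ∫⁻ s, ⨆ n, countLE n c s ∂(sampleLaw p) ≤ ENNReal.ofReal ((c + 1) / mean p) := by
  rw [lintegral_iSup (fun n => measurable_countLE n c)]
  · exact iSup_le fun n => lintegral_countLE_le p hμ n c
  · intro a b hab s
    exact Finset.sum_le_sum_of_subset (Finset.range_mono hab)

/-- The partial sums almost surely exceed every bound, because the number of partial sums below the
bound has finite expectation. -/
lemma ae_exists_lt_partialSum (p : Measure unitInterval) [IsProbabilityMeasure p]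
    (hμ : 0 < mean p) (c : ℝ) : ∀ᵐ s ∂(sampleLaw p), ∃ i, c < partialSum s i := by
  have h := ae_lt_top (Measurable.iSup fun n => measurable_countLE n c)
    ((lintegral_iSup_countLE_le p hμ c).trans_lt ENNReal.ofReal_lt_top).ne
  filter_upwards [h] with s hs
  by_contra! hc
  refine hs.ne ?_
  rw [iSup_countLE]
  simp [hc]

lemma sInf_le_iSup_countLE {c : ℝ} {s : ℕ → unitInterval} :
    ((sInf {i | c < partialSum s i} : ℕ) : ℝ≥0∞) ≤ ⨆ n, countLE n c s := by
  refine le_trans (le_of_eq ?_) (le_iSup _ (sInf {i | c < partialSum s i}))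
  have h : ∀ i ∈ Finset.range (sInf {i | c < partialSum s i}),
      (if partialSum s i ≤ c then (1 : ℝ≥0∞) else 0) = 1 := fun i hi => if_pos <| by
    have := Nat.notMem_of_lt_sInf (Finset.mem_range.1 hi)
    simpa using this
  rw [countLE, Finset.sum_congr rfl h]
  simp

lemma lintegral_sInf_le (p : Measure unitInterval) [IsProbabilityMeasure p]
    (hμ : 0 < mean p) (c : ℝ) :
    ∫⁻ s, ((sInf {i | c < partialSum s i} : ℕ) : ℝ≥0∞) ∂(sampleLaw p)
      ≤ ENNReal.ofReal ((c + 1) / mean p) :=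
  (lintegral_mono fun _ => sInf_le_iSup_countLE).trans (lintegral_iSup_countLE_le p hμ c)

/-! ### Expected waste in the tally game -/

lemma measurable_sInf_nat {α : Type*} [MeasurableSpace α] {Q : ℕ → α → Prop}
    (hQ : ∀ j, MeasurableSet {a | Q j a}) : Measurable (fun a => sInf {j | Q j a}) := by
  classical
  refine measurable_to_countable' fun n => ?_
  have : (fun a => sInf {j | Q j a}) ⁻¹' {n}
      = {a | (Q n a ∧ ∀ k < n, ¬ Q k a) ∨ (n = 0 ∧ ∀ k, ¬ Q k a)} := by
    ext a
    simp only [mem_preimage, mem_singleton_iff, mem_ofPred_eq]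
    constructor
    · rintro rfl
      rcases Set.eq_empty_or_nonempty {j | Q j a} with h | h
      · right
        exact ⟨by rw [h, Nat.sInf_empty], fun k hk => by
          have : k ∈ {j | Q j a} := hk
          rw [h] at this; exact this⟩
      · exact Or.inl ⟨Nat.sInf_mem h, fun k hk => Nat.notMem_of_lt_sInf hk⟩
    · rintro (⟨h1, h2⟩ | ⟨rfl, h⟩)
      · have hne : {j | Q j a}.Nonempty := ⟨n, h1⟩
        exact le_antisymm (Nat.sInf_le h1) (not_lt.1 fun hlt => h2 _ hlt (Nat.sInf_mem hne))
      · rw [Set.eq_empty_of_forall_notMem (s := {j | Q j a}) h, Nat.sInf_empty]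
  rw [this]
  have hn : ∀ k, MeasurableSet {a | ¬ Q k a} := fun k => (hQ k).compl
  measurability

/-- A sequence of measurable functions evaluated at a measurable index. -/
lemma measurable_apply_nat {α β : Type*} [MeasurableSpace α] [MeasurableSpace β]
    {f : ℕ → α → β} (hf : ∀ n, Measurable (f n)) {N : α → ℕ} (hN : Measurable N) :
    Measurable (fun a => f (N a) a) :=
  (measurable_from_prod_countable_right hf : Measurable fun q : ℕ × α => f q.1 q.2).comp
    (hN.prodMk measurable_id)

lemma measurableSet_lt_partialSum (c : ℝ) (i : ℕ) :
    MeasurableSet {s : ℕ → unitInterval | c < partialSum s i} :=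
  measurableSet_lt measurable_const (measurable_partialSum i)

lemma measurable_waste (z : ℝ) : Measurable (waste z) := by
  have h : Measurable (tallyLength z) := measurable_sInf_nat (measurableSet_lt_partialSum z)
  exact measurable_const.sub
    (measurable_apply_nat (f := fun n s => partialSum s (n - 1))
      (fun n => measurable_partialSum (n - 1)) h)

lemma waste_le (z : ℝ) (s : ℕ → unitInterval) : waste z s ≤ z := by
  unfold waste; linarith [partialSum_nonneg s (tallyLength z s - 1)]

lemma waste_nonneg {z : ℝ} (hz : 0 ≤ z) (s : ℕ → unitInterval) : 0 ≤ waste z s := by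
  unfold waste
  rcases Nat.eq_zero_or_pos (tallyLength z s) with h | h
  · rw [h, partialSum_zero]; linarith
  · have : tallyLength z s - 1 ∉ {h | z < partialSum s h} :=
      Nat.notMem_of_lt_sInf (Nat.sub_lt h one_pos)
    simp only [mem_ofPred_eq, not_lt] at this
    linarith

lemma waste_le_one {z : ℝ} (hz : 0 ≤ z) {s : ℕ → unitInterval}
    (hs : ∃ i, z < partialSum s i) : waste z s ≤ 1 := by
  have h1 : z < partialSum s (tallyLength z s) := Nat.sInf_mem hs
  have h0 : tallyLength z s ≠ 0 := fun h => by
    rw [h, partialSum_zero] at h1; linarith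
  have h2 := partialSum_succ_le s (tallyLength z s - 1)
  rw [Nat.sub_add_cancel (Nat.one_le_iff_ne_zero.2 h0)] at h2
  unfold waste
  linarith

lemma integrable_waste (p : Measure unitInterval) [IsProbabilityMeasure p] {z : ℝ} (hz : 0 ≤ z) :
    Integrable (waste z) (sampleLaw p) :=
  Integrable.of_bound (measurable_waste z).aestronglyMeasurable z
    (Filter.Eventually.of_forall fun s => by
      rw [Real.norm_of_nonneg (waste_nonneg hz s)]; exact waste_le z s)

lemma expectedWaste_le_one (p : Measure unitInterval) [IsProbabilityMeasure p]
    (hμ : 0 < mean p) {z : ℝ} (hz : 0 ≤ z) : expectedWaste p z ≤ 1 := by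
  have h : expectedWaste p z ≤ ∫ _, (1 : ℝ) ∂(sampleLaw p) := by
    refine integral_mono_ae (integrable_waste p hz) (integrable_const _) ?_
    filter_upwards [ae_exists_lt_partialSum p hμ z] with s hs using waste_le_one hz hs
  simpa using h

/-- The expected waste as an extended nonnegative real. -/
def lwaste (p : Measure unitInterval) (z : ℝ) : ℝ≥0∞ :=
  ∫⁻ s, ENNReal.ofReal (waste z s) ∂(sampleLaw p)

lemma lwaste_eq (p : Measure unitInterval) [IsProbabilityMeasure p] {z : ℝ} (hz : 0 ≤ z) :
    lwaste p z = ENNReal.ofReal (expectedWaste p z) :=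
  (ofReal_integral_eq_lintegral_ofReal (integrable_waste p hz)
    (Filter.Eventually.of_forall fun s => waste_nonneg hz s)).symm

lemma lwaste_le (p : Measure unitInterval) [IsProbabilityMeasure p]
    (hμ : 0 < mean p) {z : ℝ} (hz : 0 ≤ z) : lwaste p z ≤ ENNReal.ofReal (1 - beta p) := by
  rw [lwaste_eq p hz]
  refine ENNReal.ofReal_le_ofReal ?_
  have hb : BddAbove (range fun z : NNReal => expectedWaste p z) :=
    ⟨1, by rintro _ ⟨z, rfl⟩; exact expectedWaste_le_one p hμ z.2⟩
  have h1 : expectedWaste p z ≤ ⨆ z : NNReal, expectedWaste p z := le_ciSup hb ⟨z, hz⟩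
  have h2 : beta p ≤ 1 - ⨆ z : NNReal, expectedWaste p z := min_le_right _ _
  linarith

lemma waste_consSample {z : ℝ} {y : unitInterval} (hy : (y : ℝ) ≤ z) (t : ℕ → unitInterval) :
    waste (z - y) t ≤ waste z (consSample y t) := by
  have hz : 0 ≤ z := y.2.1.trans hy
  by_cases h : ∃ i, z - y < partialSum t i
  · -- If the game ends, the first sample only shifts its length by one.
    have h1 : z - y < partialSum t (tallyLength (z - y) t) := Nat.sInf_mem h
    obtain ⟨k, hk⟩ : ∃ k, tallyLength (z - y) t = k + 1 :=
      Nat.exists_eq_succ_of_ne_zero fun h0 => by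
        rw [h0, partialSum_zero] at h1; linarith
    have hlen : tallyLength z (consSample y t) = k + 2 := by
      have hmem : z < partialSum (consSample y t) (k + 2) := by
        rw [hk] at h1
        rw [partialSum_consSample]
        linarith
      refine le_antisymm (Nat.sInf_le hmem) (not_lt.1 fun hlt => ?_)
      have hm : z < partialSum (consSample y t) (tallyLength z (consSample y t)) :=
        Nat.sInf_mem (s := {h | z < partialSum (consSample y t) h}) ⟨k + 2, hmem⟩
      generalize tallyLength z (consSample y t) = l at hlt hm
      cases l with
      | zero => rw [partialSum_zero] at hm; linarith
      | succ l =>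
        rw [partialSum_consSample] at hm
        have : l ∉ {h | z - y < partialSum t h} :=
          Nat.notMem_of_lt_sInf (show l < tallyLength (z - y) t by omega)
        simp only [mem_ofPred_eq, not_lt] at this
        linarith
    unfold waste
    rw [hk, hlen, Nat.add_sub_cancel, show k + 2 - 1 = k + 1 from rfl, partialSum_consSample]
    linarith
  · -- If the game never ends, its length is `0` by convention and its waste is the threshold.
    have h1 : {i | z - y < partialSum t i} = ∅ :=
      Set.eq_empty_of_forall_notMem fun i hi => h ⟨i, hi⟩
    have h2 : {i | z < partialSum (consSample y t) i} = ∅ := by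
      refine Set.eq_empty_of_forall_notMem fun i hi => ?_
      cases i with
      | zero => simp only [mem_ofPred_eq, partialSum_zero] at hi; linarith
      | succ i =>
        simp only [mem_ofPred_eq, partialSum_consSample] at hi
        exact h ⟨i, by linarith⟩
    simp only [waste, tallyLength, h1, h2, Nat.sInf_empty, Nat.zero_sub, partialSum_zero]
    linarith [y.2.1]

lemma waste_consSample_of_lt {z : ℝ} {y : unitInterval} (hy : z < (y : ℝ))
    (t : ℕ → unitInterval) : waste z (consSample y t) = z := by
  have h1 : tallyLength z (consSample y t) ≤ 1 := Nat.sInf_le <| by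
    simp only [mem_ofPred_eq, partialSum_consSample, partialSum_zero]; linarith
  unfold waste
  rw [Nat.sub_eq_zero_of_le h1, partialSum_zero, sub_zero]

/-- The renewal inequality of the tally game, obtained by conditioning on the first sample. -/
lemma lintegral_renewal_le (p : Measure unitInterval) [IsProbabilityMeasure p] (z : ℝ) :
    ∫⁻ y, (if (y : ℝ) ≤ z then lwaste p (z - y) else ENNReal.ofReal z) ∂p ≤ lwaste p z := by
  unfold lwaste
  rw [lintegral_sampleLaw p (measurable_waste z).ennreal_ofReal]
  refine lintegral_mono fun y => ?_
  split_ifs with hy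
  · exact lintegral_mono fun t => ENNReal.ofReal_le_ofReal (waste_consSample hy t)
  · simp [waste_consSample_of_lt (not_le.1 hy)]

variable {m : ℕ} {P : Problem m} {x : LPPoint m} {s : ℕ → unitInterval}

/-! ### The functions `ω^ρ` -/

lemma cumul_zero (x : LPPoint m) : cumul x 0 = 0 := by simp [cumul]

lemma cumul_succ (x : LPPoint m) (T : ℕ) : cumul x (T + 1) = cumul x T + x.w (T + 1) := by
  simp [cumul, Finset.sum_Icc_succ_top]

lemma cumul_mono (hx : LPFeasible P x) {T T' : ℕ} (h : T ≤ T') (h' : T' ≤ P.U) :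
    cumul x T ≤ cumul x T' := by
  refine Finset.sum_le_sum_of_subset_of_nonneg (Finset.Icc_subset_Icc_right h) fun t ht _ => ?_
  rw [Finset.mem_Icc] at ht
  exact hx.w_nonneg t (Finset.mem_Icc.2 ⟨ht.1, ht.2.trans h'⟩)

lemma cumul_nonneg (hx : LPFeasible P x) {T : ℕ} (h : T ≤ P.U) : 0 ≤ cumul x T :=
  (cumul_zero x).ge.trans (cumul_mono hx (Nat.zero_le T) h)

lemma total_nonneg (hx : LPFeasible P x) : 0 ≤ total P x := cumul_nonneg hx le_rfl

/-- The lengths of the parts of the first `T` intervals between breakpoints that lie to the left of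
`z` add up to the length of the part of `[0, x_1 + ⋯ + x_T]` to the left of `z`. -/
lemma sum_w_mul_clamp (hx : LPFeasible P x) (z : ℝ) {T : ℕ} (hT : T ≤ P.U) :
    ∑ t ∈ Finset.Icc 1 T, x.w t * max 0 (min 1 ((z - cumul x (t - 1)) / x.w t))
      = max 0 (min (cumul x T) z) := by
  induction T with
  | zero => simp [cumul_zero]
  | succ T ih =>
    rw [Finset.sum_Icc_succ_top (by omega), ih (by omega), cumul_succ, Nat.add_sub_cancel]
    have hc : 0 ≤ cumul x T := cumul_nonneg hx (by omega)
    have hw : 0 ≤ x.w (T + 1) := hx.w_nonneg _ (Finset.mem_Icc.2 ⟨by omega, hT⟩)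
    generalize cumul x T = c at *
    generalize x.w (T + 1) = w at *
    rcases hw.eq_or_lt with rfl | hw'
    · simp
    rw [← mul_max_of_nonneg _ _ hw |>.symm, ← mul_min_of_nonneg _ _ hw |>.symm,
      mul_div_cancel₀ _ hw'.ne', mul_zero, mul_one]
    rcases le_total z 0 with h0 | h0
    · rw [max_eq_left (by simp [h0]), max_eq_left (min_le_of_right_le (by linarith)),
        max_eq_left (by simp [h0]), add_zero]
    rcases le_total z c with h1 | h1
    · rw [min_eq_right h1, max_eq_left (min_le_of_right_le (by linarith)), min_eq_right (by linarith),
        add_zero]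
    rw [min_eq_left h1, max_eq_right hc, max_eq_right (le_min hw (by linarith)),
      max_eq_right (le_min (by linarith) h0), ← min_add_add_left]
    congr 1
    ring

lemma clamp_mono (hx : LPFeasible P x) {t : ℕ} (ht : t ∈ Finset.Icc 1 P.U) {z z' : ℝ}
    (h : z ≤ z') : max 0 (min 1 ((z - cumul x (t - 1)) / x.w t))
      ≤ max 0 (min 1 ((z' - cumul x (t - 1)) / x.w t)) := by
  have := hx.w_nonneg t ht
  gcongr

lemma omega_mono (hx : LPFeasible P x) (ρ : Fin m) : Monotone (omega P x ρ) := fun _ _ h =>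
  Finset.sum_le_sum fun t ht =>
    mul_le_mul_of_nonneg_left (clamp_mono hx ht h) (hx.ret_nonneg t ht ρ)

/-- `ω^ρ` is 1-Lipschitz because its slopes are the ratios `x^ρ_t / x_t ≤ 1`. -/
lemma omega_sub_le (hx : LPFeasible P x) (ρ : Fin m) {z z' : ℝ} (h : z ≤ z') :
    omega P x ρ z' - omega P x ρ z ≤ z' - z := by
  have h1 : omega P x ρ z' - omega P x ρ z
      ≤ max 0 (min (total P x) z') - max 0 (min (total P x) z) := by
    unfold omega total
    rw [← sum_w_mul_clamp hx z le_rfl, ← sum_w_mul_clamp hx z' le_rfl, ← Finset.sum_sub_distrib,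
      ← Finset.sum_sub_distrib]
    refine Finset.sum_le_sum fun t ht => ?_
    rw [← mul_sub, ← mul_sub]
    exact mul_le_mul_of_nonneg_right (hx.le_w t ht ρ) (sub_nonneg.2 (clamp_mono hx ht h))
  have h2 : max 0 (min (total P x) z') - max 0 (min (total P x) z) ≤ z' - z := by
    rcases max_cases 0 (min (total P x) z') with h | h <;>
    rcases max_cases 0 (min (total P x) z) with h' | h' <;>
    rcases min_cases (total P x) z' with h'' | h'' <;>
    rcases min_cases (total P x) z with h''' | h''' <;> linarith
  linarith

lemma continuous_omega (P : Problem m) (x : LPPoint m) (ρ : Fin m) :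
    Continuous (omega P x ρ) := by
  unfold omega
  fun_prop

lemma omega_cumul (hx : LPFeasible P x) (ρ : Fin m) {T : ℕ} (hT : T ≤ P.U) :
    omega P x ρ (cumul x T) = ∑ t ∈ Finset.Icc 1 T, x.ret ρ t := by
  have hsub : Finset.Icc 1 T ⊆ Finset.Icc 1 P.U := Finset.Icc_subset_Icc_right hT
  unfold omega
  rw [← Finset.sum_subset hsub (f := fun t => x.ret ρ t *
    max 0 (min 1 ((cumul x T - cumul x (t - 1)) / x.w t)))]
  · refine Finset.sum_congr rfl fun t ht => ?_
    have hw := hx.w_nonneg t (hsub ht)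
    have hr := hx.ret_nonneg t (hsub ht) ρ
    have hle := hx.le_w t (hsub ht) ρ
    rw [Finset.mem_Icc] at ht
    rcases hw.eq_or_lt with hw0 | hw'
    · rw [show x.ret ρ t = 0 by linarith, zero_mul]
    have h1 := cumul_succ x (t - 1)
    rw [Nat.sub_add_cancel ht.1] at h1
    have h2 := cumul_mono hx ht.2 hT
    rw [min_eq_left ((one_le_div hw').2 (by linarith)), max_eq_right zero_le_one, mul_one]
  · intro t ht ht'
    have hw := hx.w_nonneg t ht
    rw [Finset.mem_Icc] at ht ht'
    have h1 := cumul_mono hx (show T ≤ t - 1 by omega) (by omega)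
    rw [max_eq_left (min_le_of_right_le (div_nonpos_of_nonpos_of_nonneg (by linarith) hw)),
      mul_zero]

lemma omega_zero (hx : LPFeasible P x) (ρ : Fin m) : omega P x ρ 0 = 0 := by
  simpa [cumul_zero] using omega_cumul hx ρ (Nat.zero_le _)

lemma omega_total (hx : LPFeasible P x) (ρ : Fin m) :
    omega P x ρ (total P x) = ∑ t ∈ Finset.Icc 1 P.U, x.ret ρ t :=
  omega_cumul hx ρ le_rfl

lemma omega_nonneg (hx : LPFeasible P x) (ρ : Fin m) (z : ℝ) : 0 ≤ omega P x ρ z :=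
  Finset.sum_nonneg fun t ht => mul_nonneg (hx.ret_nonneg t ht ρ) (le_max_left _ _)

/-- The first point at which `ω^ρ` has grown by `1` since `a`. -/
def threshold (P : Problem m) (x : LPPoint m) (ρ : Fin m) (a : ℝ) : ℝ :=
  sInf {y | 0 ≤ y ∧ omega P x ρ a + 1 ≤ omega P x ρ y}

lemma threshold_mem (hx : LPFeasible P x) {ρ : Fin m} {a : ℝ}
    (ha : 1 ≤ omega P x ρ (total P x) - omega P x ρ a) :
    0 ≤ threshold P x ρ a ∧ omega P x ρ a + 1 ≤ omega P x ρ (threshold P x ρ a) :=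
  IsClosed.csInf_mem (s := {y | 0 ≤ y ∧ omega P x ρ a + 1 ≤ omega P x ρ y})
    ((isClosed_le continuous_const continuous_id).inter
      (isClosed_le continuous_const (continuous_omega P x ρ)))
    ⟨total P x, total_nonneg hx, by linarith⟩ ⟨0, fun _ hy => hy.1⟩

lemma threshold_le {ρ : Fin m} {a y : ℝ} (hy : 0 ≤ y)
    (h : omega P x ρ a + 1 ≤ omega P x ρ y) : threshold P x ρ a ≤ y :=
  csInf_le (s := {y | 0 ≤ y ∧ omega P x ρ a + 1 ≤ omega P x ρ y}) ⟨0, fun _ hy => hy.1⟩ ⟨hy, h⟩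

lemma threshold_le_total (hx : LPFeasible P x) {ρ : Fin m} {a : ℝ}
    (ha : 1 ≤ omega P x ρ (total P x) - omega P x ρ a) : threshold P x ρ a ≤ total P x :=
  threshold_le (total_nonneg hx) (by linarith)

lemma omega_threshold (hx : LPFeasible P x) {ρ : Fin m} {a : ℝ}
    (ha : 1 ≤ omega P x ρ (total P x) - omega P x ρ a) :
    omega P x ρ (threshold P x ρ a) = omega P x ρ a + 1 := by
  refine le_antisymm ?_ (threshold_mem hx ha).2
  obtain ⟨y, hy, hya⟩ : omega P x ρ a + 1 ∈ omega P x ρ '' Icc 0 (total P x) :=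
    intermediate_value_Icc (total_nonneg hx) (continuous_omega P x ρ).continuousOn
      ⟨by rw [omega_zero hx]; linarith [omega_nonneg hx ρ a], by linarith⟩
  rw [← hya]
  exact omega_mono hx ρ (threshold_le hy.1 hya.ge)

/-- The condition on a candidate for the next local cutoff says that it is at most the
threshold. -/
lemma forall_omega_lt_iff (hx : LPFeasible P x) {ρ : Fin m} {a : ℝ}
    (ha : 1 ≤ omega P x ρ (total P x) - omega P x ρ a) (g : ℝ) :
    (∀ y, 0 ≤ y → y < g → omega P x ρ y - omega P x ρ a < 1) ↔ g ≤ threshold P x ρ a := by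
  constructor
  · intro h
    by_contra! hlt
    have := h _ (threshold_mem hx ha).1 hlt
    linarith [(threshold_mem hx ha).2]
  · intro h y hy hyg
    by_contra! hc
    have := threshold_le (P := P) (x := x) (ρ := ρ) (a := a) hy (by linarith)
    linarith

lemma add_one_le_threshold (hx : LPFeasible P x) {ρ : Fin m} {a : ℝ}
    (ha : 1 ≤ omega P x ρ (total P x) - omega P x ρ a) : a + 1 ≤ threshold P x ρ a := by
  have h1 := omega_threshold hx ha
  rcases le_total (threshold P x ρ a) a with h | h
  · have := omega_mono hx ρ h; linarith
  · have := omega_sub_le hx ρ h; linarith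

/-! ### The global and the local cutoffs -/

lemma mem_globalCutoffs {g : ℝ} :
    g ∈ globalCutoffs P x s ↔ ∃ i, (1 ≤ i ∧ i ≤ globalLength P x s) ∧ partialSum s i = g := by
  simp [globalCutoffs]

lemma lt_partialSum_globalLength (hs : ∃ i, total P x - 1 < partialSum s i) :
    total P x - 1 < partialSum s (globalLength P x s) := Nat.sInf_mem hs

lemma globalLength_le {i : ℕ} (h : total P x - 1 < partialSum s i) : globalLength P x s ≤ i :=
  Nat.sInf_le h

lemma partialSum_le_of_lt_globalLength {i : ℕ} (hi : i < globalLength P x s) :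
    partialSum s i ≤ total P x - 1 := by
  by_contra! h
  exact absurd (globalLength_le h) (not_le.2 hi)

lemma partialSum_le_total (hx : LPFeasible P x) {i : ℕ} (hi : i ≤ globalLength P x s) :
    partialSum s i ≤ total P x := by
  cases i with
  | zero => rw [partialSum_zero]; exact total_nonneg hx
  | succ i =>
    have := partialSum_le_of_lt_globalLength (P := P) (x := x) (s := s) (i := i) (by omega)
    linarith [partialSum_succ_le s i]

lemma finite_candidates (P : Problem m) (x : LPPoint m) (s : ℕ → unitInterval) (ρ : Fin m)
    (a : ℝ) : (candidates P x s ρ a).Finite :=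
  (globalCutoffs P x s).finite_toSet.subset fun _ h => h.1

lemma nonneg_of_mem_globalCutoffs {g : ℝ} (hg : g ∈ globalCutoffs P x s) : 0 ≤ g := by
  obtain ⟨i, -, rfl⟩ := mem_globalCutoffs.1 hg
  exact partialSum_nonneg s i

lemma localCutoff_nonneg (ρ : Fin m) (j : ℕ) : 0 ≤ localCutoff P x s ρ j := by
  cases j with
  | zero => exact le_rfl
  | succ j => exact Real.sSup_nonneg fun g hg => nonneg_of_mem_globalCutoffs hg.1

lemma le_localCutoff_succ {ρ : Fin m} {j : ℕ} {g : ℝ}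
    (hg : g ∈ candidates P x s ρ (localCutoff P x s ρ j)) : g ≤ localCutoff P x s ρ (j + 1) :=
  le_csSup (finite_candidates P x s ρ _).bddAbove hg

lemma localCutoff_succ_mem {ρ : Fin m} {j : ℕ}
    (h : (candidates P x s ρ (localCutoff P x s ρ j)).Nonempty) :
    localCutoff P x s ρ (j + 1) ∈ candidates P x s ρ (localCutoff P x s ρ j) :=
  h.csSup_mem (finite_candidates P x s ρ _)

/-- Consecutive global cutoffs differ by at most `1` and the last one exceeds `Û - 1`, so as long
as `ω^ρ` can still grow by `1`, some global cutoff lies in `(a, a + 1]`. -/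
lemma exists_candidate_gt (hx : LPFeasible P x) (hs : ∃ i, total P x - 1 < partialSum s i)
    {ρ : Fin m} {a : ℝ} (h0 : 0 ≤ a) (ha : 1 ≤ omega P x ρ (total P x) - omega P x ρ a) :
    ∃ g ∈ candidates P x s ρ a, a < g := by
  classical
  have hI : a < partialSum s (globalLength P x s) := by
    have h1 := add_one_le_threshold hx ha
    have h2 := threshold_le_total hx ha
    linarith [lt_partialSum_globalLength hs]
  have hex : ∃ i, a < partialSum s i := ⟨_, hI⟩
  have hlt := Nat.find_spec hex
  have hle := Nat.find_min' hex hI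
  have hmin : ∀ i < Nat.find hex, ¬ a < partialSum s i := fun i hi => Nat.find_min hex hi
  generalize Nat.find hex = k at hlt hle hmin
  cases k with
  | zero => rw [partialSum_zero] at hlt; linarith
  | succ k =>
    refine ⟨_, ⟨mem_globalCutoffs.2 ⟨k + 1, ⟨by omega, hle⟩, rfl⟩, ?_⟩, hlt⟩
    rw [forall_omega_lt_iff hx ha]
    linarith [partialSum_succ_le s k, hmin k (by omega), add_one_le_threshold hx ha]

lemma localCutoff_lt_succ (hx : LPFeasible P x) (hs : ∃ i, total P x - 1 < partialSum s i)
    {ρ : Fin m} {j : ℕ}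
    (h : 1 ≤ omega P x ρ (total P x) - omega P x ρ (localCutoff P x s ρ j)) :
    localCutoff P x s ρ j < localCutoff P x s ρ (j + 1) := by
  obtain ⟨g, hg, hlt⟩ := exists_candidate_gt hx hs (localCutoff_nonneg ρ j) h
  exact hlt.trans_le (le_localCutoff_succ hg)

lemma candidates_nonempty (hx : LPFeasible P x) (hs : ∃ i, total P x - 1 < partialSum s i)
    {ρ : Fin m} {j : ℕ}
    (h : 1 ≤ omega P x ρ (total P x) - omega P x ρ (localCutoff P x s ρ j)) :
    (candidates P x s ρ (localCutoff P x s ρ j)).Nonempty := by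
  obtain ⟨g, hg, -⟩ := exists_candidate_gt hx hs (localCutoff_nonneg ρ j) h
  exact ⟨g, hg⟩

lemma exists_localStop (hx : LPFeasible P x) (hs : ∃ i, total P x - 1 < partialSum s i)
    (ρ : Fin m) :
    ∃ j, omega P x ρ (total P x) - omega P x ρ (localCutoff P x s ρ j) < 1 := by
  -- Otherwise the local cutoffs increase forever inside the finite set of global cutoffs.
  by_contra! h
  have hmono : StrictMono (localCutoff P x s ρ) :=
    strictMono_nat_of_lt_succ fun j => localCutoff_lt_succ hx hs (h j)
  refine Set.infinite_of_injective_forall_mem (hmono.injective.comp Nat.succ_injective)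
    (s := (globalCutoffs P x s : Set ℝ)) (fun j => ?_) (Finset.finite_toSet _)
  exact (localCutoff_succ_mem (candidates_nonempty hx hs (h j))).1

lemma omega_sub_localCutoff_localLength (hx : LPFeasible P x)
    (hs : ∃ i, total P x - 1 < partialSum s i) (ρ : Fin m) :
    omega P x ρ (total P x) - omega P x ρ (localCutoff P x s ρ (localLength P x s ρ)) < 1 :=
  Nat.sInf_mem (exists_localStop hx hs ρ)

lemma localLength_le {ρ : Fin m} {j : ℕ}
    (h : omega P x ρ (total P x) - omega P x ρ (localCutoff P x s ρ j) < 1) :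
    localLength P x s ρ ≤ j := Nat.sInf_le h

lemma one_le_of_lt_localLength {ρ : Fin m} {j : ℕ} (hj : j < localLength P x s ρ) :
    1 ≤ omega P x ρ (total P x) - omega P x ρ (localCutoff P x s ρ j) := by
  by_contra! h
  exact absurd (localLength_le h) (not_le.2 hj)

lemma one_le_total_of_mem_globalCutoffs {g : ℝ} (hg : g ∈ globalCutoffs P x s) :
    1 ≤ total P x := by
  obtain ⟨i, hi, -⟩ := mem_globalCutoffs.1 hg
  have := partialSum_le_of_lt_globalLength (P := P) (x := x) (s := s) (i := 0) (by omega)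
  rw [partialSum_zero] at this
  linarith

lemma le_total_of_mem_globalCutoffs (hx : LPFeasible P x) {g : ℝ}
    (hg : g ∈ globalCutoffs P x s) : g ≤ total P x := by
  obtain ⟨i, hi, rfl⟩ := mem_globalCutoffs.1 hg
  exact partialSum_le_total hx hi.2

lemma exists_orderTime (hx : LPFeasible P x) {g : ℝ} (hg : g ∈ globalCutoffs P x s) :
    ∃ t ∈ Finset.Icc 1 P.U, g ≤ cumul x t := by
  refine ⟨P.U, Finset.mem_Icc.2 ⟨?_, le_rfl⟩, le_total_of_mem_globalCutoffs hx hg⟩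
  by_contra! h
  have := one_le_total_of_mem_globalCutoffs hg
  rw [total, show P.U = 0 by omega, cumul_zero] at this
  linarith

lemma halts (hx : LPFeasible P x) (hs : ∃ i, total P x - 1 < partialSum s i) : Halts P x s where
  globalStop := hs
  localStop := exists_localStop hx hs
  localChoice _ _ hj := candidates_nonempty hx hs (one_le_of_lt_localLength hj)
  timeExists _ hg := exists_orderTime hx hg

/-! ### Feasibility of the returned schedule -/

/-- If `ω^ρ` grows by at least `1` from `a` to `b`, then some local cutoff lies in `(a, b]`. -/
lemma exists_localCutoff_mem_Ioc (hx : LPFeasible P x)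
    (hs : ∃ i, total P x - 1 < partialSum s i) {ρ : Fin m} {a b : ℝ} (ha : 0 ≤ a) (hb : 0 ≤ b)
    (hb' : b ≤ total P x) (h : 1 ≤ omega P x ρ b - omega P x ρ a) :
    ∃ g ∈ globalCutoffs P x s, g ∈ localCutoffs P x s ρ ∧ a < g ∧ g ≤ b := by
  classical
  have hbU := omega_mono hx ρ hb'
  have hJ : a < localCutoff P x s ρ (localLength P x s ρ) := by
    by_contra! hle
    have h1 := omega_mono hx ρ hle
    linarith [omega_sub_localCutoff_localLength hx hs ρ]
  have hex : ∃ j, a < localCutoff P x s ρ j := ⟨_, hJ⟩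
  have hlt := Nat.find_spec hex
  have hle := Nat.find_min' hex hJ
  have hmin : ∀ i < Nat.find hex, ¬ a < localCutoff P x s ρ i := fun i hi => Nat.find_min hex hi
  generalize Nat.find hex = k at hlt hle hmin
  cases k with
  | zero => simp only [localCutoff] at hlt; linarith
  | succ k =>
    have hk := omega_mono hx ρ (not_lt.1 (hmin k (by omega)))
    have hmem := localCutoff_succ_mem (candidates_nonempty hx hs
      (one_le_of_lt_localLength (show k < localLength P x s ρ by omega)))
    refine ⟨_, hmem.1, ?_, hlt, ?_⟩
    · exact Finset.mem_image_of_mem _ (Finset.mem_Icc.2 ⟨by omega, hle⟩)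
    · by_contra! hgt
      linarith [hmem.2 b hb hgt]

lemma sum_Icc_eq_sub (f : ℕ → ℝ) {r d : ℕ} (hr : 1 ≤ r) (hrd : r ≤ d) :
    ∑ t ∈ Finset.Icc r d, f t = ∑ t ∈ Finset.Icc 1 d, f t - ∑ t ∈ Finset.Icc 1 (r - 1), f t := by
  have h : Finset.Icc 1 d = Finset.Icc 1 (r - 1) ∪ Finset.Icc r d := by
    ext t; simp only [Finset.mem_union, Finset.mem_Icc]; omega
  rw [h, Finset.sum_union, add_sub_cancel_left]
  rw [Finset.disjoint_left]
  intro t; simp only [Finset.mem_Icc]; omega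

lemma feasible_roundSchedule (hx : LPFeasible P x)
    (hs : ∃ i, total P x - 1 < partialSum s i) : P.Feasible (roundSchedule P x s) := by
  classical
  intro ρ r d hD
  have hr := P.release_pos ρ r d hD
  have hdU : d ≤ P.U := Finset.le_sup (f := fun q : Fin m × ℕ × ℕ => q.2.2) hD
  have hcov := hx.cover ρ r d hD
  have hrd : r ≤ d := by
    by_contra! h
    rw [Finset.Icc_eq_empty (by omega), Finset.sum_empty] at hcov
    linarith
  rw [sum_Icc_eq_sub _ hr hrd, ← omega_cumul hx ρ hdU,
    ← omega_cumul hx ρ (show r - 1 ≤ P.U by omega)] at hcov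
  obtain ⟨g, hg, hgL, hag, hgb⟩ := exists_localCutoff_mem_Ioc hx hs
    (cumul_nonneg hx (show r - 1 ≤ P.U by omega)) (cumul_nonneg hx hdU)
    (cumul_mono hx hdU le_rfl) hcov
  refine ⟨_, Finset.mem_image_of_mem _ hg, by simpa using hgL, ?_, ?_⟩
  · have hmem : orderTime P x g ∈ Finset.Icc 1 P.U ∧ g ≤ cumul x (orderTime P x g) :=
      Nat.sInf_mem (exists_orderTime hx hg)
    rw [Finset.mem_Icc] at hmem
    by_contra! hlt
    have := cumul_mono hx (show orderTime P x g ≤ r - 1 by simp only at hlt; omega) (by omega)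
    linarith
  · exact Nat.sInf_le ⟨Finset.mem_Icc.2 ⟨by omega, hdU⟩, hgb⟩

/-! ### The cost of the returned schedule -/

lemma cost_nonneg (P : Problem m) (S : Schedule m) : 0 ≤ P.cost S :=
  Finset.sum_nonneg fun _ _ => add_nonneg P.C_nonneg (Finset.sum_nonneg fun ρ _ => P.c_nonneg ρ)

lemma card_globalCutoffs_le : (globalCutoffs P x s).card ≤ globalLength P x s :=
  Finset.card_image_le.trans (by simp)

lemma card_localCutoffs_le (ρ : Fin m) : (localCutoffs P x s ρ).card ≤ localLength P x s ρ :=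
  Finset.card_image_le.trans (by simp)

lemma cost_roundSchedule_le (P : Problem m) (x : LPPoint m) (s : ℕ → unitInterval) :
    P.cost (roundSchedule P x s)
      ≤ P.C * globalLength P x s + ∑ ρ, P.c ρ * localLength P x s ρ := by
  classical
  have h1 : P.cost (roundSchedule P x s) ≤ ∑ g ∈ globalCutoffs P x s,
      (P.C + ∑ ρ ∈ Finset.univ.filter (fun ρ => g ∈ localCutoffs P x s ρ), P.c ρ) := by
    unfold Problem.cost roundSchedule
    refine (Finset.sum_image_le_of_nonneg fun o _ => ?_).trans (le_of_eq ?_)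
    · exact add_nonneg P.C_nonneg (Finset.sum_nonneg fun ρ _ => P.c_nonneg ρ)
    · congr!
  refine h1.trans ?_
  simp only [Finset.sum_filter]
  rw [Finset.sum_add_distrib, Finset.sum_comm, Finset.sum_const, nsmul_eq_mul, mul_comm]
  refine add_le_add (mul_le_mul_of_nonneg_left (by exact_mod_cast card_globalCutoffs_le)
    P.C_nonneg) (Finset.sum_le_sum fun ρ _ => ?_)
  rw [← Finset.sum_filter, Finset.sum_const, nsmul_eq_mul, mul_comm]
  refine mul_le_mul_of_nonneg_left ?_ (P.c_nonneg ρ)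
  have h2 : ((globalCutoffs P x s).filter (fun g => g ∈ localCutoffs P x s ρ)).card
      ≤ (localCutoffs P x s ρ).card :=
    Finset.card_le_card fun g hg => (Finset.mem_filter.1 hg).2
  exact_mod_cast h2.trans (card_localCutoffs_le ρ)

/-- A bound that does not depend on the choice of local cutoffs. -/
lemma cost_roundSchedule_le_globalLength (P : Problem m) (x : LPPoint m) (s : ℕ → unitInterval) :
    P.cost (roundSchedule P x s) ≤ (P.C + ∑ ρ, P.c ρ) * globalLength P x s := by
  classical
  have h : ∀ o ∈ roundSchedule P x s, P.C + ∑ ρ ∈ o.2, P.c ρ ≤ P.C + ∑ ρ, P.c ρ := fun o _ => by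
    gcongr
    · exact fun ρ _ _ => P.c_nonneg ρ
    · exact Finset.subset_univ _
  refine (Finset.sum_le_card_nsmul _ _ _ h).trans ?_
  rw [nsmul_eq_mul, mul_comm]
  refine mul_le_mul_of_nonneg_left ?_
    (add_nonneg P.C_nonneg (Finset.sum_nonneg fun ρ _ => P.c_nonneg ρ))
  exact_mod_cast Finset.card_image_le.trans card_globalCutoffs_le

/-! ### The expected number of local cutoffs -/

lemma mean_le_one (p : Measure unitInterval) [IsProbabilityMeasure p] : mean p ≤ 1 := by
  have h : mean p ≤ ∫ _, (1 : ℝ) ∂p :=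
    integral_mono (integrable_coe p) (integrable_const _) fun y => y.2.2
  simpa using h

lemma beta_le_mean (p : Measure unitInterval) : beta p ≤ mean p := min_le_left _ _

/-- The greedy choice of local cutoffs by one retailer, read off the samples one by one. In the
state `(lam, g)` the partial sum is `g`, the last local cutoff chosen so far has the threshold
`lam`, and the partial sum has not yet exceeded `lam`. When the next sample carries the partial
sum beyond `lam`, the number `g` becomes a local cutoff; this is counted if `ω^ρ` can still grow
by `1` afterwards. At most `n` samples are read. -/
def cutoffCount (P : Problem m) (x : LPPoint m) (ρ : Fin m) :
    ℕ → ℝ → ℝ → (ℕ → unitInterval) → ℕ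
  | 0, _, _, _ => 0
  | n + 1, lam, g, s =>
    if total P x - 1 < g then 0
    else if g + s 0 ≤ lam then cutoffCount P x ρ n lam (g + s 0) fun k => s (k + 1)
    else if omega P x ρ (total P x) - omega P x ρ g < 1 then 0
    else 1 + cutoffCount P x ρ n (threshold P x ρ g) (g + s 0) fun k => s (k + 1)

/-- The right-hand side is a potential for the process that `cutoffCount` follows. A sample that does
not carry the partial sum beyond `lam` preserves it on average, by the renewal inequality. When the
partial sum passes `lam`, the new threshold is the point where `ω^ρ` has grown by `1` since `g`, so
`ω^ρ` grows by at least `1 - (lam - g)` between the two thresholds because it is 1-Lipschitz. The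
waste `lam - g` that has been incurred pays for this loss, and the remaining `1` covers the
expected waste of the next round, at most `1 - beta p`, and the amount `beta p` for the count. -/
lemma lintegral_cutoffCount_le (hx : LPFeasible P x) (ρ : Fin m)
    (p : Measure unitInterval) [IsProbabilityMeasure p] (hb : 0 < beta p) (n : ℕ) {lam g : ℝ}
    (hg : g ≤ lam) (hlam : lam ≤ total P x) :
    ∫⁻ s, ENNReal.ofReal (beta p) * cutoffCount P x ρ n lam g s ∂(sampleLaw p)
      ≤ ENNReal.ofReal (omega P x ρ (total P x) - omega P x ρ lam) + lwaste p (lam - g) := by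
  have hμ : 0 < mean p := hb.trans_le (beta_le_mean p)
  have hb1 : beta p ≤ 1 := (beta_le_mean p).trans (mean_le_one p)
  induction n generalizing lam g with
  | zero => simp [cutoffCount]
  | succ n ih =>
    by_cases hend : total P x - 1 < g
    · simp [cutoffCount, hend]
    refine (lintegral_sampleLaw_le p _).trans ?_
    calc _ ≤ ∫⁻ y, (ENNReal.ofReal (omega P x ρ (total P x) - omega P x ρ lam) +
            (if (y : ℝ) ≤ lam - g then lwaste p (lam - g - y) else ENNReal.ofReal (lam - g))) ∂p := by
          refine lintegral_mono fun y => ?_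
          by_cases hy : (y : ℝ) ≤ lam - g
          · have hle : g + (y : ℝ) ≤ lam := by linarith
            have hcnt : ∀ t, cutoffCount P x ρ (n + 1) lam g (consSample y t)
                = cutoffCount P x ρ n lam (g + y) t := fun t =>
              (if_neg hend).trans (if_pos hle)
            simp only [hcnt, if_pos hy, sub_sub]
            exact ih hle hlam
          have hgt : ¬ g + (y : ℝ) ≤ lam := by linarith
          by_cases hgrow : omega P x ρ (total P x) - omega P x ρ g < 1
          · have hcnt : ∀ t, cutoffCount P x ρ (n + 1) lam g (consSample y t) = 0 := fun t =>
              (if_neg hend).trans ((if_neg hgt).trans (if_pos hgrow))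
            simp [hcnt]
          have hcnt : ∀ t, cutoffCount P x ρ (n + 1) lam g (consSample y t)
              = 1 + cutoffCount P x ρ n (threshold P x ρ g) (g + y) t := fun t =>
            (if_neg hend).trans ((if_neg hgt).trans (if_neg hgrow))
          rw [not_lt] at hgrow
          have hyle : g + (y : ℝ) ≤ threshold P x ρ g := by
            linarith [add_one_le_threshold hx hgrow, y.2.2]
          have h1 := ih hyle (threshold_le_total hx hgrow)
          have h2 := lwaste_le p hμ (sub_nonneg.2 hyle)
          have h3 := omega_sub_le hx ρ hg
          have h4 := omega_mono hx ρ hlam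
          rw [omega_threshold hx hgrow] at h1
          simp only [hcnt, if_neg hy, Nat.cast_add, Nat.cast_one, mul_add, mul_one]
          rw [lintegral_add_left measurable_const, lintegral_const, measure_univ, mul_one]
          refine (add_le_add le_rfl (h1.trans (add_le_add le_rfl h2))).trans ?_
          rw [← ENNReal.ofReal_add (by linarith) (by linarith),
            ← ENNReal.ofReal_add hb.le (by linarith),
            ← ENNReal.ofReal_add (by linarith) (by linarith)]
          exact ENNReal.ofReal_le_ofReal (by linarith)
      _ ≤ _ := by
          rw [lintegral_add_left measurable_const, lintegral_const, measure_univ, mul_one]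
          exact add_le_add le_rfl (lintegral_renewal_le p _)

/-- If the global cutoffs are exhausted at a partial sum below the threshold of the local cutoff
number `k`, then at most one more local cutoff is chosen. -/
lemma localLength_le_of_globalLength_le (hx : LPFeasible P x)
    (hs : ∃ i, total P x - 1 < partialSum s i) {ρ : Fin m} {i k : ℕ}
    (hk : k < localLength P x s ρ) (hi : i ≤ globalLength P x s)
    (hI : globalLength P x s ≤ i)
    (hle : partialSum s i ≤ threshold P x ρ (localCutoff P x s ρ k)) :
    localLength P x s ρ ≤ k + 1 := by
  obtain rfl : i = globalLength P x s := le_antisymm hi hI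
  have hgrow := one_le_of_lt_localLength hk
  obtain ⟨g, hg⟩ := candidates_nonempty hx hs hgrow
  obtain ⟨i', hi', -⟩ := mem_globalCutoffs.1 hg.1
  have hcand : partialSum s (globalLength P x s)
      ∈ candidates P x s ρ (localCutoff P x s ρ k) :=
    ⟨mem_globalCutoffs.2 ⟨_, ⟨by omega, le_rfl⟩, rfl⟩, (forall_omega_lt_iff hx hgrow _).2 hle⟩
  have h1 := le_localCutoff_succ hcand
  have h2 := lt_partialSum_globalLength hs
  have hmem := (localCutoff_succ_mem (candidates_nonempty hx hs hgrow)).1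
  have h3 := omega_sub_le hx ρ (le_total_of_mem_globalCutoffs hx hmem)
  exact localLength_le (by linarith)

/-- The greedy local cutoff is the last partial sum that does not exceed the threshold. -/
lemma localCutoff_succ_eq (hx : LPFeasible P x)
    (hs : ∃ i, total P x - 1 < partialSum s i) {ρ : Fin m} {i k : ℕ}
    (hk : k < localLength P x s ρ) (hi : i ≤ globalLength P x s)
    (hle : partialSum s i ≤ threshold P x ρ (localCutoff P x s ρ k))
    (hlt : threshold P x ρ (localCutoff P x s ρ k) < partialSum s (i + 1)) :
    localCutoff P x s ρ (k + 1) = partialSum s i := by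
  have hgrow := one_le_of_lt_localLength hk
  have hmem := localCutoff_succ_mem (candidates_nonempty hx hs hgrow)
  have hi1 : 1 ≤ i := by
    by_contra! h
    obtain rfl : i = 0 := by omega
    have h1 := add_one_le_threshold hx hgrow
    have h2 := partialSum_succ_le s 0
    rw [partialSum_zero] at h2
    linarith [localCutoff_nonneg (P := P) (x := x) (s := s) ρ k]
  refine le_antisymm ?_ (le_localCutoff_succ
    ⟨mem_globalCutoffs.2 ⟨i, ⟨hi1, hi⟩, rfl⟩, (forall_omega_lt_iff hx hgrow _).2 hle⟩)
  obtain ⟨i', -, hi'⟩ := mem_globalCutoffs.1 hmem.1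
  have h1 := (forall_omega_lt_iff hx hgrow _).1 hmem.2
  rw [← hi'] at h1 ⊢
  refine partialSum_mono s (Nat.le_of_lt_succ ?_)
  by_contra! h
  linarith [partialSum_mono s h]

/-- Started in the state reached after `i` samples and `k` local cutoffs, `cutoffCount` misses at
most the very last local cutoff. -/
lemma localLength_le_add_cutoffCount (hx : LPFeasible P x)
    (hs : ∃ i, total P x - 1 < partialSum s i) {ρ : Fin m} (n : ℕ) {i k : ℕ}
    (hk : k < localLength P x s ρ) (hi : i ≤ globalLength P x s)
    (hI : globalLength P x s ≤ i + n)
    (hle : partialSum s i ≤ threshold P x ρ (localCutoff P x s ρ k)) :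
    localLength P x s ρ ≤ k + 1 + cutoffCount P x ρ n (threshold P x ρ (localCutoff P x s ρ k))
      (partialSum s i) (fun j => s (j + i)) := by
  induction n generalizing i k with
  | zero => exact localLength_le_of_globalLength_le hx hs hk hi hI hle
  | succ n ih =>
    by_cases hend : total P x - 1 < partialSum s i
    · exact (localLength_le_of_globalLength_le hx hs hk hi (globalLength_le hend) hle).trans
        (Nat.le_add_right _ _)
    have hi' : i + 1 ≤ globalLength P x s := by
      refine Nat.lt_of_le_of_ne hi fun h => hend ?_
      rw [h]; exact lt_partialSum_globalLength hs
    have hshift : (fun j => s (j + 1 + i)) = fun j => s (j + (i + 1)) := by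
      funext j; congr 1; omega
    simp only [cutoffCount, if_neg hend, Nat.zero_add, ← partialSum_succ, hshift]
    by_cases hy : partialSum s (i + 1) ≤ threshold P x ρ (localCutoff P x s ρ k)
    · rw [if_pos hy]
      exact ih hk hi' (by omega) hy
    rw [if_neg hy]
    have heq := localCutoff_succ_eq hx hs hk hi hle (not_le.1 hy)
    rw [← heq]
    by_cases hgrow : omega P x ρ (total P x) - omega P x ρ (localCutoff P x s ρ (k + 1)) < 1
    · rw [if_pos hgrow]
      exact localLength_le hgrow
    rw [if_neg hgrow]
    have hk' : k + 1 < localLength P x s ρ := by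
      refine Nat.lt_of_le_of_ne hk fun h => hgrow ?_
      rw [h]; exact omega_sub_localCutoff_localLength hx hs ρ
    have h1 := ih hk' hi' (by omega) (by
      rw [heq]
      linarith [add_one_le_threshold hx (not_lt.1 (heq ▸ hgrow)), partialSum_succ_le s i])
    omega

/-! ### Measurability of the outcome -/

lemma measurable_globalLength (P : Problem m) (x : LPPoint m) :
    Measurable (globalLength P x) :=
  measurable_sInf_nat (measurableSet_lt_partialSum _)

/-- By monotonicity of `ω^ρ`, the condition on a candidate needs to be tested at rational points
only. -/
lemma forall_omega_lt_iff_rat (hx : LPFeasible P x) (ρ : Fin m) (a g : ℝ) :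
    (∀ y, 0 ≤ y → y < g → omega P x ρ y - omega P x ρ a < 1) ↔
      ∀ q : ℚ, 0 ≤ (q : ℝ) → (q : ℝ) < g → omega P x ρ q - omega P x ρ a < 1 := by
  refine ⟨fun h q => h q, fun h y h0 hy => ?_⟩
  obtain ⟨q, hyq, hqg⟩ := exists_rat_btwn hy
  linarith [h q (by linarith) hqg, omega_mono hx ρ hyq.le]

lemma lt_localCutoff_succ_iff (hx : LPFeasible P x) (ρ : Fin m) (j : ℕ) (c : ℝ) :
    c < localCutoff P x s ρ (j + 1) ↔ c < 0 ∨ ∃ i, 1 ≤ i ∧ i ≤ globalLength P x s ∧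
      (∀ q : ℚ, 0 ≤ (q : ℝ) → (q : ℝ) < partialSum s i →
        omega P x ρ q - omega P x ρ (localCutoff P x s ρ j) < 1) ∧ c < partialSum s i := by
  constructor
  · intro h
    rcases Set.eq_empty_or_nonempty (candidates P x s ρ (localCutoff P x s ρ j)) with he | hne
    · left
      rwa [localCutoff, he, Real.sSup_empty] at h
    · right
      have hmem := localCutoff_succ_mem hne
      obtain ⟨i, hi, heq⟩ := mem_globalCutoffs.1 hmem.1
      refine ⟨i, hi.1, hi.2, (forall_omega_lt_iff_rat hx ρ _ _).1 ?_, heq ▸ h⟩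
      rw [heq]; exact hmem.2
  · rintro (h | ⟨i, h1, hI, hq, hc⟩)
    · exact h.trans_le (localCutoff_nonneg ρ _)
    · exact hc.trans_le (le_localCutoff_succ
        ⟨mem_globalCutoffs.2 ⟨i, ⟨h1, hI⟩, rfl⟩, (forall_omega_lt_iff_rat hx ρ _ _).2 hq⟩)

lemma measurable_localCutoff (hx : LPFeasible P x) (ρ : Fin m) (j : ℕ) :
    Measurable (fun s => localCutoff P x s ρ j) := by
  induction j with
  | zero => exact measurable_const
  | succ j ih =>
    refine measurable_of_Ioi fun c => ?_
    have hset : (fun s => localCutoff P x s ρ (j + 1)) ⁻¹' Ioi c = {s | c < 0 ∨ ∃ i, 1 ≤ i ∧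
        i ≤ globalLength P x s ∧ (∀ q : ℚ, 0 ≤ (q : ℝ) → (q : ℝ) < partialSum s i →
          omega P x ρ q - omega P x ρ (localCutoff P x s ρ j) < 1) ∧ c < partialSum s i} := by
      ext s; exact lt_localCutoff_succ_iff hx ρ j c
    rw [hset]
    have hI := measurable_globalLength P x
    have h1 : ∀ i, MeasurableSet {s | i ≤ globalLength P x s} := fun i =>
      measurableSet_le measurable_const hI
    have h2 : ∀ (c : ℝ) i, MeasurableSet {s : ℕ → unitInterval | c < partialSum s i} :=
      measurableSet_lt_partialSum
    have h3 : ∀ q : ℚ, MeasurableSet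
        {s | omega P x ρ q - omega P x ρ (localCutoff P x s ρ j) < 1} := fun q =>
      measurableSet_lt (measurable_const.sub ((continuous_omega P x ρ).measurable.comp ih))
        measurable_const
    measurability

lemma measurable_localLength (hx : LPFeasible P x) (ρ : Fin m) :
    Measurable (fun s => localLength P x s ρ) :=
  measurable_sInf_nat fun j => measurableSet_lt (measurable_const.sub
    ((continuous_omega P x ρ).measurable.comp (measurable_localCutoff hx ρ j))) measurable_const

lemma mem_roundSchedule {o : Order m} :
    o ∈ roundSchedule P x s ↔ ∃ i, 1 ≤ i ∧ i ≤ globalLength P x s ∧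
      orderTime P x (partialSum s i) = o.1 ∧ ∀ ρ, (ρ ∈ o.2 ↔ ∃ j, 1 ≤ j ∧
        j ≤ localLength P x s ρ ∧ localCutoff P x s ρ j = partialSum s i) := by
  classical
  simp only [roundSchedule, localCutoffs, Finset.mem_image, mem_globalCutoffs, Finset.mem_Icc,
    Prod.ext_iff, Finset.ext_iff, Finset.mem_filter, Finset.mem_univ, true_and]
  constructor
  · rintro ⟨_, ⟨i, hi, rfl⟩, ht, hR⟩
    exact ⟨i, hi.1, hi.2, ht, fun ρ => by simpa only [and_assoc] using (hR ρ).symm⟩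
  · rintro ⟨i, h1, hI, ht, hR⟩
    exact ⟨_, ⟨i, ⟨h1, hI⟩, rfl⟩, ht, fun ρ => by simpa only [and_assoc] using (hR ρ).symm⟩

lemma measurable_orderTime (P : Problem m) (x : LPPoint m) : Measurable (orderTime P x) :=
  measurable_sInf_nat fun _ => (MeasurableSet.const _).inter
    (measurableSet_le measurable_id measurable_const)

lemma measurableSet_mem_roundSchedule (hx : LPFeasible P x) (o : Order m) :
    MeasurableSet {s | o ∈ roundSchedule P x s} := by
  simp only [mem_roundSchedule]
  have h1 : ∀ i, MeasurableSet {s | i ≤ globalLength P x s} := fun i =>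
    measurableSet_le measurable_const (measurable_globalLength P x)
  have h2 : ∀ i, MeasurableSet {s | orderTime P x (partialSum s i) = o.1} := fun i =>
    measurableSet_eq_fun ((measurable_orderTime P x).comp (measurable_partialSum i))
      measurable_const
  have h3 : ∀ j ρ, MeasurableSet {s | j ≤ localLength P x s ρ} := fun j ρ =>
    measurableSet_le measurable_const (measurable_localLength hx ρ)
  have h4 : ∀ j ρ i, MeasurableSet {s | localCutoff P x s ρ j = partialSum s i} :=
    fun j ρ i => measurableSet_eq_fun (measurable_localCutoff hx ρ j) (measurable_partialSum i)
  simp only [measurableSet_setOfPred] at *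
  exact .exists fun i => measurable_const.and <| (h1 i).and <| (h2 i).and <| .forall fun ρ =>
    measurable_const.iff <| .exists fun j => measurable_const.and <| (h3 j ρ).and (h4 j ρ i)

/-- The returned schedule takes countably many values, each on a measurable set of samples. -/
lemma measurable_cost_roundSchedule (hx : LPFeasible P x) :
    Measurable (fun s => P.cost (roundSchedule P x s)) := by
  let _ : MeasurableSpace (Schedule m) := ⊤
  have h : Measurable (roundSchedule P x) := by
    refine measurable_to_countable' fun S => ?_
    have hset : roundSchedule P x ⁻¹' {S}
        = {s | ∀ o : Order m, o ∈ roundSchedule P x s ↔ o ∈ S} := by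
      ext s; exact Finset.ext_iff
    rw [hset]
    have := measurableSet_mem_roundSchedule hx
    measurability
  exact (measurable_from_top (f := P.cost)).comp h

/-! ### The expected cost -/

lemma runCost_eq (hx : LPFeasible P x) (hs : ∃ i, total P x - 1 < partialSum s i) :
    runCost P x s = P.cost (roundSchedule P x s) := by
  simp [runCost, round, halts hx hs]

lemma lintegral_globalLength_le (P : Problem m) (x : LPPoint m)
    (p : Measure unitInterval) [IsProbabilityMeasure p] (hμ : 0 < mean p) :
    ∫⁻ s, (globalLength P x s : ℝ≥0∞) ∂(sampleLaw p)
      ≤ ENNReal.ofReal (total P x / mean p) := by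
  have h := lintegral_sInf_le p hμ (total P x - 1)
  rwa [sub_add_cancel] at h

lemma lintegral_localLength_le (hx : LPFeasible P x) (ρ : Fin m)
    (p : Measure unitInterval) [IsProbabilityMeasure p] (hb : 0 < beta p) :
    ∫⁻ s, ENNReal.ofReal (beta p) * localLength P x s ρ ∂(sampleLaw p)
      ≤ ENNReal.ofReal (omega P x ρ (total P x)) := by
  have hμ : 0 < mean p := hb.trans_le (beta_le_mean p)
  have hb1 : beta p ≤ 1 := (beta_le_mean p).trans (mean_le_one p)
  by_cases hone : 1 ≤ omega P x ρ (total P x) - omega P x ρ 0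
  swap
  · have hJ : ∀ s, localLength P x s ρ = 0 := fun s =>
      Nat.le_zero.1 (localLength_le (not_le.1 hone))
    simp [hJ]
  have hthr := add_one_le_threshold hx hone
  have hthr' := omega_threshold hx hone
  have hthr0 := (threshold_mem hx hone).1
  rw [omega_zero hx] at hone hthr'
  -- Only the samples with at most `n` global cutoffs are covered by a count over `n` samples.
  have htrunc : ∀ n : ℕ, ∫⁻ s, ENNReal.ofReal (beta p) *
      (if globalLength P x s ≤ n then (localLength P x s ρ : ℝ≥0∞) else 0) ∂(sampleLaw p)
      ≤ ENNReal.ofReal (omega P x ρ (total P x)) := by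
    intro n
    calc _ ≤ ∫⁻ s, (ENNReal.ofReal (beta p) + ENNReal.ofReal (beta p) *
            cutoffCount P x ρ n (threshold P x ρ 0) 0 s) ∂(sampleLaw p) := by
          refine lintegral_mono_ae ?_
          filter_upwards [ae_exists_lt_partialSum p hμ (total P x - 1)] with s hs
          rw [← mul_one_add]
          refine mul_le_mul_right ?_ _
          split_ifs with hn
          · rcases Nat.eq_zero_or_pos (localLength P x s ρ) with hJ | hJ
            · simp [hJ]
            have h := localLength_le_add_cutoffCount hx hs n hJ (Nat.zero_le _) (by omega)
              (by simpa [partialSum_zero, localCutoff] using hthr0)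
            simp only [partialSum_zero, localCutoff, Nat.add_zero, Nat.zero_add] at h
            exact_mod_cast h
          · exact zero_le
      _ ≤ ENNReal.ofReal (beta p) + (ENNReal.ofReal (omega P x ρ (total P x) - 1)
            + ENNReal.ofReal (1 - beta p)) := by
          rw [lintegral_add_left measurable_const, lintegral_const, measure_univ, mul_one]
          gcongr
          have h := lintegral_cutoffCount_le hx ρ p hb n hthr0
            (threshold_le_total hx (by rw [omega_zero hx]; exact hone))
          rw [hthr', zero_add] at h
          exact h.trans (add_le_add le_rfl (lwaste_le p hμ (by linarith)))
      _ = _ := by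
          rw [← ENNReal.ofReal_add (by linarith) (by linarith),
            ← ENNReal.ofReal_add hb.le (by linarith)]
          congr 1
          ring
  have hsup : ∀ s, ENNReal.ofReal (beta p) * (localLength P x s ρ : ℝ≥0∞)
      = ⨆ n : ℕ, ENNReal.ofReal (beta p) *
        (if globalLength P x s ≤ n then (localLength P x s ρ : ℝ≥0∞) else 0) := by
    intro s
    refine le_antisymm ?_ (iSup_le fun n => mul_le_mul_right (by split_ifs <;> simp) _)
    exact le_iSup_of_le (globalLength P x s) (by simp)
  simp_rw [hsup]
  rw [lintegral_iSup]
  · exact iSup_le htrunc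
  · exact fun n => measurable_const.mul (Measurable.ite
      (measurableSet_le (measurable_globalLength P x) measurable_const)
      (measurable_from_nat.comp (measurable_localLength hx ρ)) measurable_const)
  · intro a b hab s
    refine mul_le_mul_right ?_ _
    by_cases h : globalLength P x s ≤ a
    · simp [h, h.trans hab]
    · simp [h]

lemma integrable_runCost (hx : LPFeasible P x) (p : Measure unitInterval)
    [IsProbabilityMeasure p] (hμ : 0 < mean p) :
    Integrable (runCost P x) (sampleLaw p) := by
  have hI : Integrable (fun s => (globalLength P x s : ℝ)) (sampleLaw p) := by
    refine ⟨(measurable_from_nat.comp (measurable_globalLength P x)).aestronglyMeasurable, ?_⟩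
    refine lt_of_le_of_lt (le_of_eq ?_) ((lintegral_globalLength_le P x p hμ).trans_lt
      ENNReal.ofReal_lt_top)
    exact lintegral_congr fun s => by simp
  have hcost : Integrable (fun s => P.cost (roundSchedule P x s)) (sampleLaw p) := by
    refine (hI.const_mul (P.C + ∑ ρ, P.c ρ)).mono'
      (measurable_cost_roundSchedule hx).aestronglyMeasurable (Filter.Eventually.of_forall ?_)
    intro s
    rw [Real.norm_of_nonneg (cost_nonneg P _)]
    exact cost_roundSchedule_le_globalLength P x s
  refine hcost.congr ?_
  filter_upwards [ae_exists_lt_partialSum p hμ (total P x - 1)] with s hs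
  exact (runCost_eq hx hs).symm

lemma lpCost_eq (hx : LPFeasible P x) :
    lpCost P x = P.C * total P x + ∑ ρ, P.c ρ * omega P x ρ (total P x) := by
  simp only [omega_total hx, lpCost, Finset.sum_add_distrib]
  rw [Finset.sum_comm, total, cumul]
  simp only [Finset.mul_sum]

lemma lpCost_nonneg (hx : LPFeasible P x) : 0 ≤ lpCost P x := by
  rw [lpCost_eq hx]
  exact add_nonneg (mul_nonneg P.C_nonneg (total_nonneg hx))
    (Finset.sum_nonneg fun ρ _ => mul_nonneg (P.c_nonneg ρ) (omega_nonneg hx ρ _))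

lemma integral_runCost_le (hx : LPFeasible P x) (p : Measure unitInterval)
    [IsProbabilityMeasure p] (hb : 0 < beta p) :
    ∫ s, runCost P x s ∂(sampleLaw p) ≤ lpCost P x / beta p := by
  have hμ : 0 < mean p := hb.trans_le (beta_le_mean p)
  have hae := ae_exists_lt_partialSum p hμ (total P x - 1)
  have hmI : Measurable fun s => (globalLength P x s : ℝ≥0∞) :=
    measurable_from_nat.comp (measurable_globalLength P x)
  have hmJ : ∀ ρ, Measurable fun s => (localLength P x s ρ : ℝ≥0∞) := fun ρ =>
    measurable_from_nat.comp (measurable_localLength hx ρ)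
  have hnn : 0 ≤ᵐ[sampleLaw p] runCost P x := by
    filter_upwards [hae] with s hs
    rw [runCost_eq hx hs]; exact cost_nonneg P _
  rw [le_div_iff₀ hb, mul_comm, ← integral_const_mul,
    ← ENNReal.ofReal_le_ofReal_iff (lpCost_nonneg hx), ofReal_integral_eq_lintegral_ofReal
      ((integrable_runCost hx p hμ).const_mul _)
      (by filter_upwards [hnn] with s hs using mul_nonneg hb.le hs)]
  calc _ ≤ ∫⁻ s, (ENNReal.ofReal P.C * (ENNReal.ofReal (beta p) * globalLength P x s) +
          ∑ ρ, ENNReal.ofReal (P.c ρ) * (ENNReal.ofReal (beta p) * localLength P x s ρ))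
          ∂(sampleLaw p) := by
        refine lintegral_mono_ae ?_
        filter_upwards [hae] with s hs
        rw [runCost_eq hx hs]
        refine (ENNReal.ofReal_le_ofReal (mul_le_mul_of_nonneg_left
          (cost_roundSchedule_le P x s) hb.le)).trans (le_of_eq ?_)
        rw [ENNReal.ofReal_mul hb.le, ENNReal.ofReal_add
          (mul_nonneg P.C_nonneg (Nat.cast_nonneg _))
          (Finset.sum_nonneg fun ρ _ => mul_nonneg (P.c_nonneg ρ) (Nat.cast_nonneg _)),
          ENNReal.ofReal_sum_of_nonneg
            (fun ρ _ => mul_nonneg (P.c_nonneg ρ) (Nat.cast_nonneg _)),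
          ENNReal.ofReal_mul P.C_nonneg, ENNReal.ofReal_natCast, mul_add, Finset.mul_sum,
          mul_left_comm]
        congr 1
        refine Finset.sum_congr rfl fun ρ _ => ?_
        rw [ENNReal.ofReal_mul (P.c_nonneg ρ), ENNReal.ofReal_natCast, mul_left_comm]
    _ = ENNReal.ofReal P.C * (ENNReal.ofReal (beta p) *
          ∫⁻ s, (globalLength P x s : ℝ≥0∞) ∂(sampleLaw p)) +
          ∑ ρ, ENNReal.ofReal (P.c ρ) *
            ∫⁻ s, ENNReal.ofReal (beta p) * localLength P x s ρ ∂(sampleLaw p) := by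
        rw [lintegral_add_left ((hmI.const_mul _).const_mul _),
          lintegral_const_mul _ (hmI.const_mul _), lintegral_const_mul _ hmI,
          lintegral_finsetSum _ fun ρ _ => ((hmJ ρ).const_mul _).const_mul _]
        congr 1
        exact Finset.sum_congr rfl fun ρ _ => lintegral_const_mul _ ((hmJ ρ).const_mul _)
    _ ≤ ENNReal.ofReal P.C * ENNReal.ofReal (total P x) +
          ∑ ρ, ENNReal.ofReal (P.c ρ) * ENNReal.ofReal (omega P x ρ (total P x)) := by
        gcongr with ρ
        · refine (mul_le_mul_right (lintegral_globalLength_le P x p hμ) _).trans ?_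
          rw [← ENNReal.ofReal_mul hb.le]
          refine ENNReal.ofReal_le_ofReal ?_
          rw [mul_div_left_comm]
          exact mul_le_of_le_one_right (total_nonneg hx) ((div_le_one hμ).2 (beta_le_mean p))
        · exact lintegral_localLength_le hx ρ p hb
    _ = ENNReal.ofReal (lpCost P x) := by
        rw [lpCost_eq hx, ENNReal.ofReal_add (mul_nonneg P.C_nonneg (total_nonneg hx))
          (Finset.sum_nonneg fun ρ _ => mul_nonneg (P.c_nonneg ρ) (omega_nonneg hx ρ _)),
          ENNReal.ofReal_mul P.C_nonneg, ENNReal.ofReal_sum_of_nonneg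
            (fun ρ _ => mul_nonneg (P.c_nonneg ρ) (omega_nonneg hx ρ _))]
        congr 1
        exact Finset.sum_congr rfl fun ρ _ => (ENNReal.ofReal_mul (P.c_nonneg ρ)).symm

end JRPD

end

theorem mainTheorem2 {m : ℕ} (P : JRPD.Problem m) (x : JRPD.LPPoint m)
    (hx : JRPD.LPFeasible P x)
    (p : MeasureTheory.Measure unitInterval) [MeasureTheory.IsProbabilityMeasure p]
    (hp : p ≠ MeasureTheory.Measure.dirac 0) :
    (∀ᵐ s ∂(JRPD.sampleLaw p), ∃ S, JRPD.round P x s = some S ∧ P.Feasible S) ∧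
    MeasureTheory.Integrable (JRPD.runCost P x) (JRPD.sampleLaw p) ∧
    (0 < JRPD.beta p →
      ∫ s, JRPD.runCost P x s ∂(JRPD.sampleLaw p) ≤ JRPD.lpCost P x / JRPD.beta p) := by
  have hμ := JRPD.mean_pos p hp
  refine ⟨?_, JRPD.integrable_runCost hx p hμ, JRPD.integral_runCost_le hx p⟩
  filter_upwards [JRPD.ae_exists_lt_partialSum p hμ (JRPD.total P x - 1)] with s hs
  exact ⟨JRPD.roundSchedule P x s, if_pos (JRPD.halts hx hs), JRPD.feasible_roundSchedule hx hs⟩
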